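/- Let $d\ge 0$, let $k_1,\dots,k_d$ be positive integers, $k=\sum_i k_i$, and let $\mathcal Y$ be a set. **Data.** For every $y\in\mathcal Y$ the observation $x\in\mathbb R^d$ is $x=h(z)$, where $h:\mathbb R^d\to\mathbb R^d$ and the latent variable $z\in\mathbb R^d$ has, conditionally on $y$, the Lebesgue density $$p(z\mid y)=\mu(z)\exp\Big(\sum_{i=1}^d T_i(z_i)^{\top}\lambda_i(y)-\Gamma(y)\Big),$$ with an arbitrary (not necessarily factorial) measurable $\mu\ge 0$, sufficient statistics $T_i:\mathbb R\to\mathbb R^{k_i}$, parameters $\lambda_i:\mathcal Y\to\mathbb R^{k_i}$ and normalizing term $\Gamma$. Assume: 1. Every $T_i$ is differentiable and strongly exponential: if $\theta\in\mathbb R^{k_i}$ and $T_i(\cdot)^\top\theta$ is constant on a set of positive Lebesgue measure, then $\theta=0$. 2. There are points $y_0,\dots,y_k\in\mathcal Y$ such that the $k\times k$ matrix $L=(\lambda(y_1)-\lambda(y_0),\dots,\lambda(y_k)-\lambda(y_0))$, with $\lambda=(\lambda_1,\dots,\lambda_d)$, is invertible. **Fit.** Let $f:\mathbb R^d\to\mathbb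 R^d$, let $H_i:\mathbb R\to\mathbb R^{m_i}$ be differentiable, where $(m_1,\dots,m_d)$ is a rearrangement of $(k_1,\dots,k_d)$, and let $g_i:\mathcal Y\to\mathbb R^{m_i}$ be functions such that for every $y\in\mathcal Y$ the constant $Z(y)=\int\exp(-\sum_i H_i(f_i(x))^\top g_i(y))\,dx$ is finite and the model density $$Z(y)^{-1}\exp\Big(-\sum_{i=1}^d H_i(f_i(x))^\top g_i(y)\Big)$$ is a density of the true conditional distribution of $x$ given $y$ (the infinite-data limit of a consistent estimator). **Regularity.** Assume one of the following: * (A) $k_i\ge 2$ for all $i$, every $T_i$ is twice differentiable, and $h$ and $f$ are $\mathcal D^2$-diffeomorphisms of $\mathbb R^d$ (bijective and twice differentiable, with twice differentiable inverse); * (B) $k_i=1$ and $T_i$ is not monotonic (neither non-decreasing nor non-increasing) for all $i$, and $h$ and $f$ are $\mathcal C^1$-diffeomorphisms of $\mathbb R^d$ (this holds in particular if they are $\mathcal D^2$-diffeomorphisms). **Conclusion.** There are a permutation $\gamma$ of $\{1,\dots,d\}$ with $m_i=k_{\gamma(i)}$, invertible square matrices $A_i$ and vectors $b_i$ such that for every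 $i$ and all $z\in\mathbb R^d$, with $x=h(z)$, $$H_i(f_i(x))=A_i\,T_{\gamma(i)}(z_{\gamma(i)})+b_i ,$$ i.e. the latent variables are recovered up to a block permutation, invertible linear maps and pointwise nonlinearities. -/

import Mathlib

open MeasureTheory
open scoped ENNReal Matrix

noncomputable section

/-- `φ` is twice (Fréchet) differentiable; the second derivative need not be continuous. -/
def TwiceDifferentiable {E F : Type*} [NormedAddCommGroup E] [NormedSpace ℝ E]
    [NormedAddCommGroup F] [NormedSpace ℝ F] (φ : E → F) : Prop :=
  Differentiable ℝ φ ∧ Differentiable ℝ (fderiv ℝ φ)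

/-- A `𝒟²`-diffeomorphism of `ℝ^d`: an invertible map which is twice differentiable together with
its inverse. -/
def IsD2Diffeo {d : ℕ} (φ : (Fin d → ℝ) → (Fin d → ℝ)) : Prop :=
  ∃ ψ : (Fin d → ℝ) → (Fin d → ℝ), Function.LeftInverse ψ φ ∧ Function.RightInverse ψ φ ∧
    TwiceDifferentiable φ ∧ TwiceDifferentiable ψ

/-- A `𝒞¹`-diffeomorphism of `ℝ^d`: an invertible map which is continuously differentiable together
with its inverse. -/
def IsC1Diffeo {d : ℕ} (φ : (Fin d → ℝ) → (Fin d → ℝ)) : Prop :=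
  ∃ ψ : (Fin d → ℝ) → (Fin d → ℝ), Function.LeftInverse ψ φ ∧ Function.RightInverse ψ φ ∧
    ContDiff ℝ 1 φ ∧ ContDiff ℝ 1 ψ

/-- A sufficient statistic `T : ℝ → ℝ^n` is strongly exponential if no nontrivial linear combination
of its components is constant on a set of positive Lebesgue measure. -/
def StronglyExponential {n : ℕ} (T : ℝ → Fin n → ℝ) : Prop :=
  ∀ (s : Set ℝ) (θ : Fin n → ℝ), (∃ c : ℝ, ∀ t ∈ s, T t ⬝ᵥ θ = c) → volume s = 0 ∨ θ = 0

/-- The conditional density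
`p(z | y) = μ(z) exp (∑ i, T_i(z_i)ᵀ λ_i(y) - Γ(y))` of the latent variable. -/
def latentDensity {d : ℕ} {k : Fin d → ℕ} {Y : Type*}
    (T : ∀ i, ℝ → Fin (k i) → ℝ) (lam : ∀ i, Y → Fin (k i) → ℝ)
    (μ : (Fin d → ℝ) → ℝ) (Γ : Y → ℝ) (y : Y) (z : Fin d → ℝ) : ℝ :=
  μ z * Real.exp ((∑ i, T i (z i) ⬝ᵥ lam i y) - Γ y)

/-- The conditional laws `P y` of the observation `x` given `y` are those of the exponential IMCA
model: `x = h(z)`, where `z` has the density `latentDensity T lam μ Γ y` given `y`. The base measure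
`μ` is arbitrary, and `Γ` normalizes. -/
structure FollowsIMCA {d : ℕ} {k : Fin d → ℕ} {Y : Type*}
    (h : (Fin d → ℝ) → (Fin d → ℝ))
    (T : ∀ i, ℝ → Fin (k i) → ℝ) (lam : ∀ i, Y → Fin (k i) → ℝ)
    (μ : (Fin d → ℝ) → ℝ) (Γ : Y → ℝ) (P : Y → Measure (Fin d → ℝ)) : Prop where
  measurable_base : Measurable μ
  base_nonneg : ∀ z, 0 ≤ μ z
  normalized : ∀ y, ∫⁻ z, ENNReal.ofReal (latentDensity T lam μ Γ y z) = 1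
  law : ∀ y, P y =
    (volume.withDensity fun z => ENNReal.ofReal (latentDensity T lam μ Γ y z)).map h

/-- The matrix `L = (λ(y_1) - λ(y_0), …, λ(y_k) - λ(y_0))` of size `k × k`, `k = ∑ i, k_i`, where
`λ = (λ_1, …, λ_d)`. Rows and columns are both indexed by the `k` pairs `(i, j)` with `j < k_i`. -/
def lambdaDiffMatrix {d : ℕ} {k : Fin d → ℕ} {Y : Type*} (lam : ∀ i, Y → Fin (k i) → ℝ)
    (y₀ : Y) (y : (Σ i, Fin (k i)) → Y) :
    Matrix (Σ i, Fin (k i)) (Σ i, Fin (k i)) ℝ :=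
  Matrix.of fun r l => lam r.1 (y l) r.2 - lam r.1 y₀ r.2

/-- The energy `H(f(x))ᵀ g(y)`, where `H(f(x)) = (H_1(f_1(x)), …, H_d(f_d(x)))`. -/
def iceEnergy {d : ℕ} {m : Fin d → ℕ} {Y : Type*}
    (H : ∀ i, ℝ → Fin (m i) → ℝ) (f : (Fin d → ℝ) → (Fin d → ℝ))
    (g : ∀ i, Y → Fin (m i) → ℝ) (y : Y) (x : Fin d → ℝ) : ℝ :=
  ∑ i, H i (f x i) ⬝ᵥ g i y

/-- The normalizing constant `Z(y) = ∫ exp (-H(f(x))ᵀ g(y)) dx`. -/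
def icePartition {d : ℕ} {m : Fin d → ℕ} {Y : Type*}
    (H : ∀ i, ℝ → Fin (m i) → ℝ) (f : (Fin d → ℝ) → (Fin d → ℝ))
    (g : ∀ i, Y → Fin (m i) → ℝ) (y : Y) : ℝ≥0∞ :=
  ∫⁻ x, ENNReal.ofReal (Real.exp (-iceEnergy H f g y x))

/-- The model density `exp (-H(f(x))ᵀ g(y)) / Z(y)`. -/
def iceDensity {d : ℕ} {m : Fin d → ℕ} {Y : Type*}
    (H : ∀ i, ℝ → Fin (m i) → ℝ) (f : (Fin d → ℝ) → (Fin d → ℝ))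
    (g : ∀ i, Y → Fin (m i) → ℝ) (y : Y) (x : Fin d → ℝ) : ℝ≥0∞ :=
  ENNReal.ofReal (Real.exp (-iceEnergy H f g y x)) / icePartition H f g y

/-- The energy model is well defined (finite normalizing constants) and its conditional
distributions are the true ones `P y`: the limit of a consistent fit. -/
structure FitsExactly {d : ℕ} {m : Fin d → ℕ} {Y : Type*}
    (H : ∀ i, ℝ → Fin (m i) → ℝ) (f : (Fin d → ℝ) → (Fin d → ℝ))
    (g : ∀ i, Y → Fin (m i) → ℝ) (P : Y → Measure (Fin d → ℝ)) : Prop where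
  partition_finite : ∀ y, icePartition H f g y < ∞
  law : ∀ y, P y = volume.withDensity (iceDensity H f g y)

end

/-! Comparing the laws at two values of `y` cancels the base measure `μ` and the Jacobian of `h`.
The fitted densities are positive and all exponents are continuous, so the energy differences agree
everywhere up to a constant (`exists_sum_dotProduct_sub_eq`). Inverting `L` gives `T j (z j) = ∑ i,
A j i *ᵥ H i (v z i) + c j` with `v = f ∘ h`. Put `u = v⁻¹`: then `T j (u w j)` is a sum of
functions of one coordinate each, and it remains to show that it depends on a single coordinate.

Case (A): the mixed derivatives of `T j (u w j)` vanish. If two partials of `u j` were nonzero at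
one point, `T j''` would be parallel to `T j'` on an interval, so `T j'` would have a locally fixed
direction there, against strong exponentiality in dimension at least two. Hence each row of the
Jacobian of `u` has one nonzero entry, whose position is constant by connectedness.

Case (B): `T j` has a critical point `t j`. On the hyperplane `z j = t j`, every `H s` with `A j s ≠
0` is critical at `v z s`; since `H s` is constant on no interval, `v · s` is constant on the
hyperplane. Two such `s` would give proportional rows in the invertible Jacobian of `v`, so each row
of `A` has one nonzero entry.

In both cases a block `T (γ i)` is affine in `H i`; strong exponentiality and a dimension count make
the linear part invertible. -/

/-! ### Equality of laws and the affine relation between statistics and features -/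

theorem map_withDensity_of_leftInverse {α β : Type*} [MeasurableSpace α] [MeasurableSpace β]
    (ν : Measure α) {h : α → β} {ψ : β → α} (hh : Measurable h) (hψ : Measurable ψ)
    (hψh : Function.LeftInverse ψ h) {r : α → ℝ≥0∞} (hr : Measurable r) :
    (ν.withDensity r).map h = (ν.map h).withDensity (r ∘ ψ) := by
  ext s hs
  rw [Measure.map_apply hh hs, withDensity_apply _ (hh hs), withDensity_apply _ hs,
    setLIntegral_map hs (hr.comp hψ) hh]
  simp [hψh _]

theorem iceDensity_eq_ofReal_exp {d : ℕ} {m : Fin d → ℕ} {Y : Type*}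
    {H : ∀ i, ℝ → Fin (m i) → ℝ} {f : (Fin d → ℝ) → (Fin d → ℝ)}
    {g : ∀ i, Y → Fin (m i) → ℝ} {y : Y} (hE : Measurable (iceEnergy H f g y))
    (hZ : icePartition H f g y < ∞) (x : Fin d → ℝ) :
    iceDensity H f g y x = ENNReal.ofReal
      (Real.exp (-iceEnergy H f g y x - Real.log (icePartition H f g y).toReal)) := by
  have hZ0 : icePartition H f g y ≠ 0 := by
    intro h0
    rw [icePartition, lintegral_eq_zero_iff (by fun_prop)] at h0
    obtain ⟨x, hx⟩ := h0.exists
    exact absurd hx (by simp [Real.exp_pos])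
  have hpos : 0 < (icePartition H f g y).toReal := ENNReal.toReal_pos hZ0 hZ.ne
  rw [iceDensity, Real.exp_sub, Real.exp_log hpos, ENNReal.ofReal_div_of_pos hpos,
    ENNReal.ofReal_toReal hZ.ne]

/-- Equality of the conditional laws makes the differences of the two energies agree everywhere, up
to an additive constant. -/
theorem exists_sum_dotProduct_sub_eq {d : ℕ} {k m : Fin d → ℕ} {Y : Type*}
    {h ψ : (Fin d → ℝ) → (Fin d → ℝ)}
    {T : ∀ i, ℝ → Fin (k i) → ℝ} {lam : ∀ i, Y → Fin (k i) → ℝ}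
    {μ : (Fin d → ℝ) → ℝ} {Γ : Y → ℝ} {P : Y → Measure (Fin d → ℝ)}
    {H : ∀ i, ℝ → Fin (m i) → ℝ} {f : (Fin d → ℝ) → (Fin d → ℝ)}
    {g : ∀ i, Y → Fin (m i) → ℝ}
    (hdata : FollowsIMCA h T lam μ Γ P) (hfit : FitsExactly H f g P)
    (hT : ∀ i, Continuous (T i)) (hH : ∀ i, Continuous (H i))
    (hh : Continuous h) (hψ : Continuous ψ) (hf : Continuous f)
    (hψh : Function.LeftInverse ψ h) (y y' : Y) :
    ∃ c : ℝ, ∀ z, ∑ i, T i (z i) ⬝ᵥ (lam i y' - lam i y) =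
      -(∑ i, H i (f (h z) i) ⬝ᵥ (g i y' - g i y)) + c := by
  have hE : ∀ y, Continuous (iceEnergy H f g y) := fun y => by
    unfold iceEnergy dotProduct
    fun_prop
  set S : Y → (Fin d → ℝ) → ℝ := fun y z => (∑ i, T i (z i) ⬝ᵥ lam i y) - Γ y with hS
  have hSc : ∀ y, Continuous (S y) := fun y => by
    simp only [hS, dotProduct]
    fun_prop
  set ζ : Y → ℝ := fun y => Real.log (icePartition H f g y).toReal with hζ
  set r : (Fin d → ℝ) → ℝ := fun z => Real.exp (S y' z - S y z) with hr
  have hrc : Continuous r := by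
    simp only [hr]
    fun_prop
  have hq : ∀ y, P y = volume.withDensity
      fun x => ENNReal.ofReal (Real.exp (-iceEnergy H f g y x - ζ y)) := fun y => by
    rw [hfit.law y]
    congr 1
    ext x
    exact iceDensity_eq_ofReal_exp (hE y).measurable (hfit.partition_finite y) x
  have hμ := hdata.measurable_base
  have hlat : Measurable fun z => ENNReal.ofReal (latentDensity T lam μ Γ y z) := by
    have := (hSc y).measurable
    change Measurable fun z => ENNReal.ofReal (μ z * Real.exp (S y z))
    fun_prop
  have hrm : Measurable fun z => ENNReal.ofReal (r z) := by fun_prop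
  -- Multiplying by the ratio `r` avoids dividing by `μ`, which may vanish; under `h` the ratio
  -- merely becomes `r ∘ ψ`.
  have hP : P y' = (P y).withDensity ((fun z => ENNReal.ofReal (r z)) ∘ ψ) := by
    rw [hdata.law y', hdata.law y,
      ← map_withDensity_of_leftInverse _ hh.measurable hψ.measurable hψh hrm,
      ← withDensity_mul _ hlat hrm]
    congr 2
    ext z
    have hnn : 0 ≤ latentDensity T lam μ Γ y z :=
      mul_nonneg (hdata.base_nonneg z) (Real.exp_pos _).le
    rw [Pi.mul_apply, ← ENNReal.ofReal_mul hnn]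
    congr 1
    change μ z * Real.exp (S y' z) = μ z * Real.exp (S y z) * Real.exp (S y' z - S y z)
    rw [mul_assoc, ← Real.exp_add]
    congr 2
    ring
  have hEm : ∀ y, Measurable (iceEnergy H f g y) := fun y => (hE y).measurable
  have hEy := hEm y
  have hEy' := hEm y'
  -- Replacing `P y` by its model density makes the identity hold Lebesgue-a.e., even where `μ` is
  -- zero.
  rw [hq y', hq y, ← withDensity_mul _ (by fun_prop) (hrm.comp hψ.measurable),
    withDensity_eq_iff_of_sigmaFinite (by fun_prop)
      (Measurable.aemeasurable (by have := hrm.comp hψ.measurable; fun_prop))] at hP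
  have key : (fun x => -iceEnergy H f g y' x - ζ y') = fun x =>
      (-iceEnergy H f g y x - ζ y) + (S y' (ψ x) - S y (ψ x)) := by
    have h1 := hE y
    have h2 := hE y'
    have h3 := (hSc y).comp hψ
    have h4 := (hSc y').comp hψ
    refine (Continuous.ae_eq_iff_eq volume (by fun_prop) (by fun_prop)).1 ?_
    filter_upwards [hP] with x hx
    simp only [Pi.mul_apply, Function.comp_apply, hr] at hx
    rwa [← ENNReal.ofReal_mul (Real.exp_pos _).le, ← Real.exp_add,
      ENNReal.ofReal_eq_ofReal_iff (Real.exp_pos _).le (Real.exp_pos _).le,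
      Real.exp_eq_exp] at hx
  refine ⟨Γ y' - Γ y - (ζ y' - ζ y), fun z => ?_⟩
  have := congrFun key (h z)
  simp only [hψh z, iceEnergy, hS] at this
  simp only [dotProduct_sub, Finset.sum_sub_distrib]
  linarith

/-- The sufficient statistics of the latent variable are affine functions of the fitted
features. -/
theorem exists_affine_of_isUnit_lambdaDiffMatrix {d : ℕ} {k m : Fin d → ℕ} {Y : Type*}
    {h ψ : (Fin d → ℝ) → (Fin d → ℝ)}
    {T : ∀ i, ℝ → Fin (k i) → ℝ} {lam : ∀ i, Y → Fin (k i) → ℝ}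
    {μ : (Fin d → ℝ) → ℝ} {Γ : Y → ℝ} {P : Y → Measure (Fin d → ℝ)}
    {H : ∀ i, ℝ → Fin (m i) → ℝ} {f : (Fin d → ℝ) → (Fin d → ℝ)}
    {g : ∀ i, Y → Fin (m i) → ℝ}
    (hdata : FollowsIMCA h T lam μ Γ P) (hfit : FitsExactly H f g P)
    (hL : ∃ (y₀ : Y) (y : (Σ i, Fin (k i)) → Y), IsUnit (lambdaDiffMatrix lam y₀ y))
    (hT : ∀ i, Continuous (T i)) (hH : ∀ i, Continuous (H i))
    (hh : Continuous h) (hψ : Continuous ψ) (hf : Continuous f)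
    (hψh : Function.LeftInverse ψ h) :
    ∃ (A : ∀ j i, Matrix (Fin (k j)) (Fin (m i)) ℝ) (c : ∀ j, Fin (k j) → ℝ),
      ∀ z j, T j (z j) = ∑ i, A j i *ᵥ H i (f (h z) i) + c j := by
  obtain ⟨y₀, y, hL⟩ := hL
  choose c hc using fun l =>
    exists_sum_dotProduct_sub_eq hdata hfit hT hH hh hψ hf hψh y₀ (y l)
  set L := lambdaDiffMatrix lam y₀ y with hLdef
  let G : Matrix (Σ i, Fin (k i)) (Σ i, Fin (m i)) ℝ :=
    Matrix.of fun l r => -(g r.1 (y l) r.2 - g r.1 y₀ r.2)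
  have hdet : IsUnit Lᵀ.det := by
    rw [Matrix.det_transpose]
    exact (Matrix.isUnit_iff_isUnit_det _).1 hL
  have hmul : ∀ z : Fin d → ℝ, Lᵀ *ᵥ (fun r : Σ i, Fin (k i) => T r.1 (z r.1) r.2) =
      G *ᵥ (fun r : Σ i, Fin (m i) => H r.1 (f (h z) r.1) r.2) + c := by
    intro z
    ext l
    have := hc l z
    simp only [dotProduct, Pi.sub_apply] at this
    simp only [Matrix.mulVec, dotProduct, Pi.add_apply, Fintype.sum_sigma, Matrix.transpose_apply,
      hLdef, lambdaDiffMatrix, Matrix.of_apply, G, neg_mul, Finset.sum_neg_distrib]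
    simpa only [mul_comm] using this
  refine ⟨fun j i => Matrix.of fun a b => ((Lᵀ)⁻¹ * G) ⟨j, a⟩ ⟨i, b⟩,
    fun j a => ((Lᵀ)⁻¹ *ᵥ c) ⟨j, a⟩, fun z j => ?_⟩
  have hinv := congrArg (fun w => (Lᵀ)⁻¹ *ᵥ w) (hmul z)
  simp only [Matrix.mulVec_mulVec, Matrix.mulVec_add, Matrix.nonsing_inv_mul _ hdet,
    Matrix.one_mulVec] at hinv
  ext a
  have := congrFun hinv ⟨j, a⟩
  rw [Pi.add_apply] at this ⊢
  rw [this, Finset.sum_apply]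
  simp only [Matrix.mulVec, dotProduct, Fintype.sum_sigma, Matrix.of_apply]

/-! ### Invertibility of the blocks -/

/-- The block sizes are only propositionally equal, hence the explicit `e` and a two-sided inverse
in place of `IsUnit`. -/
theorem exists_inverse_of_vecMul_eq_zero {n n' : ℕ} (e : n = n') (M : Matrix (Fin n) (Fin n') ℝ)
    (hM : ∀ θ, θ ᵥ* M = 0 → θ = 0) :
    ∃ B : Matrix (Fin n') (Fin n) ℝ, B * M = 1 ∧ M * B = 1 := by
  subst e
  have hU : IsUnit M := Matrix.vecMul_injective_iff_isUnit.1 fun a b hab =>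
    sub_eq_zero.1 (hM _ (by
      rw [Matrix.sub_vecMul]
      exact sub_eq_zero.2 hab))
  have hdet := (Matrix.isUnit_iff_isUnit_det _).1 hU
  exact ⟨M⁻¹, Matrix.nonsing_inv_mul _ hdet, Matrix.mul_nonsing_inv _ hdet⟩

theorem le_of_vecMul_eq_zero {n n' : ℕ} (M : Matrix (Fin n) (Fin n') ℝ)
    (hM : ∀ θ, θ ᵥ* M = 0 → θ = 0) : n ≤ n' := by
  have hinj : Function.Injective M.vecMulLinear := by
    rw [← LinearMap.ker_eq_bot, LinearMap.ker_eq_bot']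
    exact hM
  simpa using LinearMap.finrank_le_finrank_of_injective hinj

theorem eq_zero_of_dotProduct_eq_const {n : ℕ} {T : ℝ → Fin n → ℝ} (hT : StronglyExponential T)
    {a b : ℝ} (hab : a < b) {θ : Fin n → ℝ} {c : ℝ} (hc : ∀ t ∈ Set.Icc a b, T t ⬝ᵥ θ = c) :
    θ = 0 :=
  (hT (Set.Icc a b) θ ⟨c, hc⟩).resolve_left (by simp [hab])

/-- If each block `T (γ i)` is a function of the `i`-th coordinate of `v` alone, then it is an
invertible affine function of `H i`. -/
theorem exists_block_affine {d : ℕ} {k m : Fin d → ℕ}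
    {T : ∀ i, ℝ → Fin (k i) → ℝ} {H : ∀ i, ℝ → Fin (m i) → ℝ}
    {u v : (Fin d → ℝ) → (Fin d → ℝ)}
    (huv : ∀ z, u (v z) = z) (hvu : ∀ w, v (u w) = w)
    (hTexp : ∀ i, StronglyExponential (T i))
    (hdim : ∃ σ : Equiv.Perm (Fin d), ∀ i, m i = k (σ i))
    {A : ∀ j i, Matrix (Fin (k j)) (Fin (m i)) ℝ} {c : ∀ j, Fin (k j) → ℝ}
    (hA : ∀ z j, T j (z j) = ∑ i, A j i *ᵥ H i (v z i) + c j)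
    (γ : Equiv.Perm (Fin d))
    (hγ : ∀ i w w', w i = w' i → T (γ i) (u w (γ i)) = T (γ i) (u w' (γ i))) :
    ∃ (A : ∀ i, Matrix (Fin (m i)) (Fin (k (γ i))) ℝ) (b : ∀ i, Fin (m i) → ℝ),
      ∀ i, m i = k (γ i) ∧
        (∃ B : Matrix (Fin (k (γ i))) (Fin (m i)) ℝ, A i * B = 1 ∧ B * A i = 1) ∧
        ∀ z : Fin d → ℝ, H i (v z i) = A i *ᵥ T (γ i) (z (γ i)) + b i := by
  have hblock : ∀ i, ∃ e : Fin (k (γ i)) → ℝ,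
      ∀ z, T (γ i) (z (γ i)) = A (γ i) i *ᵥ H i (v z i) + e := by
    intro i
    -- By `hγ` all coordinates of `v z` other than `i` may be set to `0`; their contribution is the
    -- constant.
    refine ⟨(∑ l ∈ Finset.univ.erase i, A (γ i) l *ᵥ H l 0 : Fin (k (γ i)) → ℝ) + c (γ i),
      fun z => ?_⟩
    have h1 := hγ i (v z) (Function.update 0 i (v z i)) (by simp)
    rw [huv] at h1
    rw [h1, hA, hvu, ← Finset.add_sum_erase _ _ (Finset.mem_univ i), Function.update_self,
      add_assoc]
    congr 2
    refine Finset.sum_congr rfl fun l hl => ?_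
    rw [Function.update_of_ne (Finset.ne_of_mem_erase hl), Pi.zero_apply]
  choose e he using hblock
  have hker : ∀ i θ, θ ᵥ* A (γ i) i = 0 → θ = 0 := by
    intro i θ hθ
    refine eq_zero_of_dotProduct_eq_const (hTexp (γ i)) zero_lt_one (c := e i ⬝ᵥ θ) fun t _ => ?_
    have := he i (fun _ => t)
    rw [this, add_dotProduct, dotProduct_comm, Matrix.dotProduct_mulVec, hθ, zero_dotProduct,
      zero_add]
  have hle : ∀ i, k (γ i) ≤ m i := fun i => le_of_vecMul_eq_zero _ (hker i)
  -- Blockwise inequalities with equal totals are equalities.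
  have hsum : ∑ i, k (γ i) = ∑ i, m i := by
    obtain ⟨σ, hσ⟩ := hdim
    simp only [hσ]
    rw [Equiv.sum_comp γ k, Equiv.sum_comp σ k]
  have heq : ∀ i, k (γ i) = m i := fun i =>
    (Finset.sum_eq_sum_iff_of_le fun i _ => hle i).1 hsum i (Finset.mem_univ i)
  choose B hBA hAB using fun i => exists_inverse_of_vecMul_eq_zero (heq i) _ (hker i)
  refine ⟨B, fun i => -(B i *ᵥ e i), fun i => ⟨(heq i).symm, ⟨_, hBA i, hAB i⟩, fun z => ?_⟩⟩
  rw [he, Matrix.mulVec_add, Matrix.mulVec_mulVec, hBA, Matrix.one_mulVec]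
  simp

/-! ### Jacobian rows and derivatives along lines -/

theorem LinearMap.apply_eq_sum_mul_apply_single {d : ℕ} (L : (Fin d → ℝ) →ₗ[ℝ] (Fin d → ℝ))
    (x : Fin d → ℝ) (i : Fin d) : L x i = ∑ l, x l * L (Pi.single l 1) i := by
  conv_lhs => rw [pi_eq_sum_univ' x]
  simp only [map_sum, map_smul, Finset.sum_apply, Pi.smul_apply, smul_eq_mul]

/-- Two rows of a surjective linear map that are supported on the same coordinate coincide. -/
theorem LinearMap.eq_of_surjective_of_apply_single_eq_zero {d : ℕ}
    {L : (Fin d → ℝ) →ₗ[ℝ] (Fin d → ℝ)} (hL : Function.Surjective L) {s i j : Fin d}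
    (hi : ∀ l, l ≠ s → L (Pi.single l 1) i = 0) (hj : ∀ l, l ≠ s → L (Pi.single l 1) j = 0) :
    i = j := by
  by_contra hij
  have hrow : ∀ (x) (i), (∀ l, l ≠ s → L (Pi.single l 1) i = 0) →
      L x i = x s * L (Pi.single s 1) i := fun x i hi => by
    rw [L.apply_eq_sum_mul_apply_single, Finset.sum_eq_single s]
    · exact fun l _ hl => by rw [hi l hl, mul_zero]
    · simp
  obtain ⟨x, hx⟩ := hL (Pi.single i 1)
  obtain ⟨x', hx'⟩ := hL (Pi.single j 1)
  have h1 := hrow x i hi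
  have h2 := hrow x j hj
  have h3 := hrow x' j hj
  rw [hx, Pi.single_eq_same] at h1
  rw [hx, Pi.single_eq_of_ne (Ne.symm hij)] at h2
  rw [hx', Pi.single_eq_same] at h3
  rcases mul_eq_zero.1 h2.symm with h | h
  · simp [h] at h1
  · simp [h] at h3

theorem surjective_fderiv_of_inverse {d : ℕ} {u v : (Fin d → ℝ) → (Fin d → ℝ)}
    (hu : Differentiable ℝ u) (hv : Differentiable ℝ v)
    (huv : ∀ z, u (v z) = z) (hvu : ∀ w, v (u w) = w) (w : Fin d → ℝ) :
    Function.Surjective (fderiv ℝ u w) := by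
  have hcomp : HasFDerivAt (u ∘ v) (fderiv ℝ u w ∘L fderiv ℝ v (u w)) (u w) := by
    refine HasFDerivAt.comp _ ?_ (hv _).hasFDerivAt
    rw [hvu]
    exact (hu w).hasFDerivAt
  have hid : u ∘ v = id := funext huv
  rw [hid] at hcomp
  have heq := hcomp.unique (hasFDerivAt_id _)
  intro x
  exact ⟨fderiv ℝ v (u w) x, by simpa using DFunLike.congr_fun heq x⟩

theorem hasDerivAt_line {d : ℕ} (w e : Fin d → ℝ) (r : ℝ) :
    HasDerivAt (fun r : ℝ => w + r • e) e r := by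
  simpa using ((hasDerivAt_id r).smul_const e).const_add w

theorem hasDerivAt_apply_line {d : ℕ} {u : (Fin d → ℝ) → (Fin d → ℝ)} (hu : Differentiable ℝ u)
    (w e : Fin d → ℝ) (j : Fin d) (r : ℝ) :
    HasDerivAt (fun r : ℝ => u (w + r • e) j) (fderiv ℝ u (w + r • e) e j) r :=
  (hasDerivAt_pi.1 (((hu _).hasFDerivAt).comp_hasDerivAt r (hasDerivAt_line w e r))) j

theorem const_on_Icc_of_hasDerivAt_zero {f : ℝ → ℝ} {a b : ℝ}
    (hf : ∀ t ∈ Set.Icc a b, HasDerivAt f 0 t) : ∀ t ∈ Set.Icc a b, f t = f a :=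
  constant_of_has_deriv_right_zero (fun t ht => (hf t ht).continuousAt.continuousWithinAt)
    fun t ht => (hf t (Set.Ico_subset_Icc_self ht)).hasDerivWithinAt

theorem hasDerivAt_dotProduct_const {n : ℕ} {T : ℝ → Fin n → ℝ} {T' : Fin n → ℝ} {t : ℝ}
    (hT : HasDerivAt T T' t) (θ : Fin n → ℝ) :
    HasDerivAt (fun t => T t ⬝ᵥ θ) (T' ⬝ᵥ θ) t := by
  simp only [dotProduct]
  exact HasDerivAt.fun_sum fun a _ => (hasDerivAt_pi.1 hT a).mul_const _

/-! ### Case (A): statistics of dimension at least two -/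

/-- A curve of dimension at least two whose second derivative is parallel to the first lies on a
line over some interval, so it is not strongly exponential. -/
theorem not_stronglyExponential_of_deriv_deriv_parallel {n : ℕ} (hn : 2 ≤ n)
    {T : ℝ → Fin n → ℝ} (hT : Differentiable ℝ T) (hT' : Differentiable ℝ (deriv T))
    {a b : ℝ} (hab : a < b)
    (hpar : ∀ t ∈ Set.Icc a b, ∃ κ : ℝ, deriv (deriv T) t = κ • deriv T t) :
    ¬ StronglyExponential T := by
  intro hexp
  have : Nontrivial (Fin n) := Fin.nontrivial_iff_two_le.2 hn
  have hθ : ∀ {a b : ℝ} (θ : Fin n → ℝ), a < b →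
      (∀ t ∈ Set.Icc a b, deriv T t ⬝ᵥ θ = 0) → θ = 0 := fun θ hab h =>
    eq_zero_of_dotProduct_eq_const hexp hab (const_on_Icc_of_hasDerivAt_zero fun t ht => by
      simpa only [h t ht] using hasDerivAt_dotProduct_const (hT t).hasDerivAt θ)
  -- Otherwise `T` would be constant on a subinterval.
  obtain ⟨t₀, ht₀, i, hi⟩ : ∃ t ∈ Set.Ioo a b, ∃ i, deriv T t i ≠ 0 := by
    by_contra! hzero
    obtain ⟨a', haa', ha'b⟩ := exists_between hab
    obtain ⟨b', hab', hbb'⟩ := exists_between ha'b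
    obtain ⟨i⟩ : Nonempty (Fin n) := inferInstance
    have h1 : (Pi.single i 1 : Fin n → ℝ) = 0 := hθ _ hab' fun t ht => by
      rw [dotProduct_single, hzero t ⟨haa'.trans_le ht.1, ht.2.trans_lt hbb'⟩ i, zero_mul]
    simpa using congrFun h1 i
  have hcoord : ∀ l t, HasDerivAt (fun t => deriv T t l) (deriv (deriv T) t l) t := fun l t =>
    hasDerivAt_pi.1 (hT' t).hasDerivAt l
  have hev : ∀ᶠ t in nhds t₀, t ∈ Set.Icc a b ∧ deriv T t i ≠ 0 :=
    (Filter.eventually_of_mem (Icc_mem_nhds ht₀.1 ht₀.2) fun _ ht => ht).and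
      ((hcoord i t₀).continuousAt.eventually_ne hi)
  obtain ⟨ε, hε, hball⟩ := Metric.eventually_nhds_iff_ball.1 hev
  have hsub : ∀ t ∈ Set.Icc (t₀ - ε / 2) (t₀ + ε / 2), t ∈ Set.Icc a b ∧ deriv T t i ≠ 0 :=
    fun t ht => hball t (by
      rw [Metric.mem_ball, Real.dist_eq, abs_lt]
      constructor <;> linarith [ht.1, ht.2])
  obtain ⟨l, hl⟩ := exists_ne i
  -- Parallelism makes the ratio of two components of `T'` constant, so `e_l - κ e_i` annihilates
  -- `T'` near `t₀`.
  set κ := deriv T (t₀ - ε / 2) l / deriv T (t₀ - ε / 2) i with hκ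
  have hratio : ∀ t ∈ Set.Icc (t₀ - ε / 2) (t₀ + ε / 2), deriv T t l / deriv T t i = κ :=
    const_on_Icc_of_hasDerivAt_zero fun t ht => by
      obtain ⟨htab, hti⟩ := hsub t ht
      obtain ⟨ρ, hρ⟩ := hpar t htab
      have := (hcoord l t).div (hcoord i t) hti
      have hz : deriv (deriv T) t l * deriv T t i - deriv T t l * deriv (deriv T) t i = 0 := by
        rw [hρ, Pi.smul_apply, Pi.smul_apply, smul_eq_mul, smul_eq_mul]
        ring
      rw [hz, zero_div] at this
      exact this
  have h0 : (Pi.single l 1 - κ • Pi.single i 1 : Fin n → ℝ) = 0 :=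
    hθ (a := t₀ - ε / 2) (b := t₀ + ε / 2) _ (by linarith) fun t ht => by
      have h1 := hratio t ht
      rw [div_eq_iff (hsub t ht).2] at h1
      rw [dotProduct_sub, dotProduct_smul, dotProduct_single, dotProduct_single, h1, smul_eq_mul]
      ring
  simpa [hl] using congrFun h0 l

/-- The composition of two twice differentiable maps is twice differentiable. -/
theorem TwiceDifferentiable.comp {E F G : Type*} [NormedAddCommGroup E] [NormedSpace ℝ E]
    [NormedAddCommGroup F] [NormedSpace ℝ F] [NormedAddCommGroup G] [NormedSpace ℝ G]
    {ψ : F → G} {φ : E → F} (hψ : TwiceDifferentiable ψ) (hφ : TwiceDifferentiable φ) :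
    TwiceDifferentiable fun x => ψ (φ x) := by
  refine ⟨hψ.1.comp hφ.1, ?_⟩
  have : fderiv ℝ (fun x => ψ (φ x)) = fun x => fderiv ℝ ψ (φ x) ∘L fderiv ℝ φ x :=
    funext fun x => fderiv_comp x (hψ.1 _) (hφ.1 x)
  rw [this]
  exact (hψ.2.comp hφ.1).clm_comp hφ.2

/-- If each component of a diffeomorphism has at most one nonzero partial derivative at each point,
then, up to a permutation, each component is a function of one coordinate. -/
theorem exists_perm_of_mul_partial_eq_zero {d : ℕ} {u v : (Fin d → ℝ) → (Fin d → ℝ)}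
    (hu : Differentiable ℝ u) (hu' : Continuous (fderiv ℝ u)) (hv : Differentiable ℝ v)
    (huv : ∀ z, u (v z) = z) (hvu : ∀ w, v (u w) = w)
    (horth : ∀ j w s t, s ≠ t →
      fderiv ℝ u w (Pi.single s 1) j * fderiv ℝ u w (Pi.single t 1) j = 0) :
    ∃ γ : Equiv.Perm (Fin d), ∀ i w w', w i = w' i → u w (γ i) = u w' (γ i) := by
  have hsurj := surjective_fderiv_of_inverse hu hv huv hvu
  have hcont : ∀ s j, Continuous fun w => fderiv ℝ u w (Pi.single s 1) j := fun s j =>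
    (continuous_apply j).comp (hu'.clm_apply continuous_const)
  have hex : ∀ j w, ∃ s, fderiv ℝ u w (Pi.single s 1) j ≠ 0 := by
    intro j w
    by_contra! hzero
    obtain ⟨x, hx⟩ := hsurj w (Pi.single j 1)
    have := (fderiv ℝ u w).toLinearMap.apply_eq_sum_mul_apply_single x j
    simp only [ContinuousLinearMap.coe_coe, hx, hzero, mul_zero, Finset.sum_const_zero,
      Pi.single_eq_same] at this
    exact one_ne_zero this
  choose s hs using fun j => hex j 0
  have hne : ∀ j w, fderiv ℝ u w (Pi.single (s j) 1) j ≠ 0 := by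
    intro j
    -- Connectedness: off the set where the partial along `s j` is nonzero, some other partial is
    -- nonzero, so this set is clopen.
    have hopen : ∀ t, IsOpen {w | fderiv ℝ u w (Pi.single t 1) j ≠ 0} := fun t =>
      isOpen_ne_fun (hcont t j) continuous_const
    have hclosed : IsClosed {w | fderiv ℝ u w (Pi.single (s j) 1) j ≠ 0} := by
      rw [← isOpen_compl_iff]
      have : {w | fderiv ℝ u w (Pi.single (s j) 1) j ≠ 0}ᶜ =
          ⋃ t ∈ {t | t ≠ s j}, {w | fderiv ℝ u w (Pi.single t 1) j ≠ 0} := by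
        ext w
        simp only [Set.mem_compl_iff, Set.mem_ofPred_eq, not_not, Set.mem_iUnion, exists_prop]
        constructor
        · intro h
          obtain ⟨t, ht⟩ := hex j w
          exact ⟨t, fun hts => ht (hts ▸ h), ht⟩
        · rintro ⟨t, hts, ht⟩
          exact (mul_eq_zero.1 (horth j w t (s j) hts)).resolve_left ht
      rw [this]
      exact isOpen_biUnion fun t _ => hopen t
    have huniv := IsClopen.eq_univ ⟨hclosed, hopen (s j)⟩ ⟨0, hs j⟩
    exact fun w => (Set.eq_univ_iff_forall.1 huniv) w
  have hzero : ∀ j w t, t ≠ s j → fderiv ℝ u w (Pi.single t 1) j = 0 := fun j w t ht =>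
    (mul_eq_zero.1 (horth j w t (s j) ht)).resolve_right (hne j w)
  have hinj : Function.Injective s := fun i j hij =>
    LinearMap.eq_of_surjective_of_apply_single_eq_zero (L := (fderiv ℝ u 0).toLinearMap)
      (s := s i) (hsurj 0) (hzero i 0) (by rw [hij]; exact hzero j 0)
  set σ := Equiv.ofBijective s (Finite.injective_iff_bijective.1 hinj) with hσ
  refine ⟨σ.symm, fun i w w' hww' => ?_⟩
  have hsi : s (σ.symm i) = i := Equiv.ofBijective_apply_symm_apply s _ i
  -- On the segment from `w` to `w'`, the direction has no `i`-component and all other partials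
  -- vanish.
  have hconst : ∀ r, HasDerivAt (fun r : ℝ => u (w + r • (w' - w)) (σ.symm i)) 0 r := by
    intro r
    have h1 := hasDerivAt_apply_line hu w (w' - w) (σ.symm i) r
    have h2 := (fderiv ℝ u (w + r • (w' - w))).toLinearMap.apply_eq_sum_mul_apply_single
      (w' - w) (σ.symm i)
    rw [Finset.sum_eq_zero] at h2
    · rw [ContinuousLinearMap.coe_coe] at h2
      rwa [h2] at h1
    · intro l _
      by_cases hl : l = i
      · rw [hl, Pi.sub_apply, hww', sub_self, zero_mul]
      · rw [ContinuousLinearMap.coe_coe, hzero _ _ l (by rwa [hsi]), mul_zero]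
  have := is_const_of_deriv_eq_zero (fun r => (hconst r).differentiableAt)
    (fun r => (hconst r).deriv) 0 1
  simpa using this

theorem exists_perm_of_twiceDifferentiable {d : ℕ} {k m : Fin d → ℕ}
    {T : ∀ i, ℝ → Fin (k i) → ℝ} {H : ∀ i, ℝ → Fin (m i) → ℝ}
    {u v : (Fin d → ℝ) → (Fin d → ℝ)}
    (hu : TwiceDifferentiable u) (hv : Differentiable ℝ v)
    (huv : ∀ z, u (v z) = z) (hvu : ∀ w, v (u w) = w)
    (hk : ∀ i, 2 ≤ k i) (hT : ∀ i, TwiceDifferentiable (T i))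
    (hTexp : ∀ i, StronglyExponential (T i)) (hH : ∀ i, Differentiable ℝ (H i))
    {A : ∀ j i, Matrix (Fin (k j)) (Fin (m i)) ℝ} {c : ∀ j, Fin (k j) → ℝ}
    (hA : ∀ z j, T j (z j) = ∑ i, A j i *ᵥ H i (v z i) + c j) :
    ∃ γ : Equiv.Perm (Fin d), ∀ i w w', w i = w' i → u w (γ i) = u w' (γ i) := by
  have hT' : ∀ j, Differentiable ℝ (deriv (T j)) := fun j => by
    have : deriv (T j) = fun t => fderiv ℝ (T j) t 1 := by
      ext t
      rw [fderiv_apply_one_eq_deriv]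
    rw [this]
    exact (hT j).2.clm_apply (differentiable_const _)
  have hp : ∀ s j, Differentiable ℝ fun w => fderiv ℝ u w (Pi.single s 1) j := fun s j =>
    differentiable_pi.1 (hu.2.clm_apply (differentiable_const _)) j
  -- the partial derivative of `T j ∘ u j` along `s` only depends on the coordinate `s`
  have hfirst : ∀ j s w, fderiv ℝ u w (Pi.single s 1) j • deriv (T j) (u w j) =
      A j s *ᵥ deriv (H s) (w s) := by
    intro j s w
    have h1 : HasDerivAt (fun r : ℝ => T j (u (w + r • Pi.single s 1) j))
        (fderiv ℝ u w (Pi.single s 1) j • deriv (T j) (u w j)) 0 := by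
      have := hasDerivAt_apply_line hu.1 w (Pi.single s 1) j 0
      have h2 := HasDerivAt.scomp (0 : ℝ) (((hT j).1 _).hasDerivAt) this
      simp only [zero_smul, add_zero] at h2
      exact h2
    have h2 : HasDerivAt (fun r : ℝ => T j (u (w + r • Pi.single s 1) j))
        (A j s *ᵥ deriv (H s) (w s)) 0 := by
      have heq : (fun r : ℝ => T j (u (w + r • Pi.single s 1) j)) = fun r : ℝ =>
          A j s *ᵥ H s (w s + r) + (∑ i ∈ Finset.univ.erase s, A j i *ᵥ H i (w i) + c j) := by
        ext1 r
        rw [hA, hvu, ← Finset.add_sum_erase _ _ (Finset.mem_univ s), add_assoc]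
        congr 2
        · simp
        · refine Finset.sum_congr rfl fun i hi => ?_
          simp [Finset.ne_of_mem_erase hi]
      rw [heq]
      refine HasDerivAt.add_const _ ?_
      have h3 : HasDerivAt (fun r : ℝ => H s (w s + r)) (deriv (H s) (w s)) 0 := by
        have := HasDerivAt.comp_const_add (w s) 0 (f := H s) (f' := deriv (H s) (w s))
          (by rw [add_zero]; exact (hH s _).hasDerivAt)
        exact this
      exact ((Matrix.mulVecLin (A j s)).toContinuousLinearMap.hasFDerivAt).comp_hasDerivAt
        (0 : ℝ) h3
    exact h1.unique h2
  -- Differentiate `hfirst` along `t`: its right side depends on `w s` only, so no second derivative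
  -- of `H s` is needed.
  have hsecond : ∀ j s t w, s ≠ t →
      (fderiv ℝ u w (Pi.single s 1) j * fderiv ℝ u w (Pi.single t 1) j) •
        deriv (deriv (T j)) (u w j) +
      fderiv ℝ (fun w => fderiv ℝ u w (Pi.single s 1) j) w (Pi.single t 1) •
        deriv (T j) (u w j) = 0 := by
    intro j s t w hst
    have h1 : HasDerivAt (fun r : ℝ => fderiv ℝ u (w + r • Pi.single t 1) (Pi.single s 1) j)
        (fderiv ℝ (fun w => fderiv ℝ u w (Pi.single s 1) j) w (Pi.single t 1)) 0 := by
      have := ((hp s j _).hasFDerivAt).comp_hasDerivAt (0 : ℝ) (hasDerivAt_line w (Pi.single t 1) 0)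
      simp only [zero_smul, add_zero] at this
      exact this
    have h2 : HasDerivAt (fun r : ℝ => deriv (T j) (u (w + r • Pi.single t 1) j))
        (fderiv ℝ u w (Pi.single t 1) j • deriv (deriv (T j)) (u w j)) 0 := by
      have := hasDerivAt_apply_line hu.1 w (Pi.single t 1) j 0
      have h2 := HasDerivAt.scomp (0 : ℝ) ((hT' j _).hasDerivAt) this
      simp only [zero_smul, add_zero] at h2
      exact h2
    have h3 := h1.smul h2
    have h4 : HasDerivAt (fun r : ℝ => fderiv ℝ u (w + r • Pi.single t 1) (Pi.single s 1) j •
        deriv (T j) (u (w + r • Pi.single t 1) j)) 0 0 := by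
      simp only [hfirst, Pi.add_apply, Pi.smul_apply, Pi.single_eq_of_ne hst, smul_zero, add_zero]
      exact hasDerivAt_const _ _
    have h5 := h3.unique h4
    simp only [zero_smul, add_zero, smul_smul] at h5
    exact h5
  refine exists_perm_of_mul_partial_eq_zero hu.1 hu.2.continuous hv huv hvu fun j w₀ s t hst => ?_
  by_contra hne
  -- the nonvanishing persists for `u w j` in an interval around `u w₀ j`
  set e : Fin d → ℝ := Pi.single j 1
  -- Along this preimage of a line, `u · j` moves at unit speed and so covers an interval of
  -- arguments of `T j`.
  set path : ℝ → (Fin d → ℝ) := fun r => v (u w₀ + r • e) with hpath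
  have hpathc : Continuous path := hv.continuous.comp (by fun_prop)
  have hev : ∀ᶠ r in nhds (0 : ℝ), fderiv ℝ u (path r) (Pi.single s 1) j *
      fderiv ℝ u (path r) (Pi.single t 1) j ≠ 0 := by
    refine ContinuousAt.eventually_ne ?_ (by simpa [hpath, hvu] using hne)
    exact (((hp s j).continuous.comp hpathc).mul ((hp t j).continuous.comp hpathc)).continuousAt
  obtain ⟨ε, hε, hball⟩ := Metric.eventually_nhds_iff_ball.1 hev
  refine not_stronglyExponential_of_deriv_deriv_parallel (hk j) (hT j).1 (hT' j)
    (a := u w₀ j) (b := u w₀ j + ε / 2) (by linarith) (fun τ hτ => ?_) (hTexp j)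
  have hr := hball (τ - u w₀ j) (by
    rw [Metric.mem_ball, Real.dist_eq, abs_lt]
    constructor <;> linarith [hτ.1, hτ.2])
  have h1 := hsecond j s t (path (τ - u w₀ j)) hst
  have h2 : u (path (τ - u w₀ j)) j = τ := by simp [hpath, huv, e]
  rw [h2] at h1
  refine ⟨-(fderiv ℝ u (path (τ - u w₀ j)) (Pi.single s 1) j *
    fderiv ℝ u (path (τ - u w₀ j)) (Pi.single t 1) j)⁻¹ *
    fderiv ℝ (fun w => fderiv ℝ u w (Pi.single s 1) j) (path (τ - u w₀ j)) (Pi.single t 1), ?_⟩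
  rw [mul_smul, ← neg_eq_of_add_eq_zero_right h1, neg_smul, smul_neg, neg_neg, smul_smul,
    inv_mul_cancel₀ hr, one_smul]

/-! ### Case (B): scalar non-monotonic statistics -/

/-- Darboux: a derivative without zeros has constant sign, even if it is discontinuous. -/
theorem exists_deriv_eq_zero_of_not_monotone_of_not_antitone {f : ℝ → ℝ}
    (hf : Differentiable ℝ f) (hmono : ¬ Monotone f) (hanti : ¬ Antitone f) :
    ∃ t, deriv f t = 0 := by
  by_contra! hne
  rcases hasDerivWithinAt_forall_lt_or_forall_gt_of_forall_ne (f := f) (f' := deriv f) (m := 0)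
    convex_univ (fun x _ => (hf x).hasDerivAt.hasDerivWithinAt) (fun x _ => hne x) with h | h
  · exact hanti (antitone_of_deriv_nonpos hf fun x => (h x trivial).le)
  · exact hmono (monotone_of_deriv_nonneg hf fun x => (h x trivial).le)

/-- The case of one-dimensional sufficient statistics, in scalar form. -/
theorem exists_perm_of_not_monotone {d : ℕ} {T H : Fin d → ℝ → ℝ}
    {u v : (Fin d → ℝ) → (Fin d → ℝ)}
    (hu : Differentiable ℝ u) (hv : Differentiable ℝ v)
    (huv : ∀ z, u (v z) = z) (hvu : ∀ w, v (u w) = w)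
    (hT : ∀ i, Differentiable ℝ (T i)) (hH : ∀ i, Differentiable ℝ (H i))
    (hTconst : ∀ i a b c, a < b → ¬ ∀ t ∈ Set.Icc a b, T i t = c)
    (hmono : ∀ i, ¬ Monotone (T i) ∧ ¬ Antitone (T i))
    {A : Matrix (Fin d) (Fin d) ℝ} {c : Fin d → ℝ}
    (hA : ∀ z j, T j (z j) = ∑ i, A j i * H i (v z i) + c j) :
    ∃ γ : Equiv.Perm (Fin d), ∀ i w w', w i = w' i → T (γ i) (u w (γ i)) = T (γ i) (u w' (γ i)) := by
  have hA' : ∀ z, (fun j => T j (z j) - c j) = A *ᵥ fun i => H i (v z i) := fun z => by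
    ext j
    rw [hA z j, add_sub_cancel_right]
    rfl
  -- A left kernel vector `θ` would make `∑ j, θ j * T j (z j)` constant; varying one coordinate
  -- forces `θ j = 0`.
  have hU : IsUnit A := by
    refine Matrix.vecMul_injective_iff_isUnit.1 fun a b hab => sub_eq_zero.1 ?_
    set θ := a - b
    have hθ : θ ᵥ* A = 0 := by
      rw [Matrix.sub_vecMul]
      exact sub_eq_zero.2 hab
    have hconst : ∀ z : Fin d → ℝ, ∑ j, θ j * T j (z j) = ∑ j, θ j * c j := fun z => by
      have h1 : θ ⬝ᵥ (fun j => T j (z j) - c j) = 0 := by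
        rw [hA', Matrix.dotProduct_mulVec, hθ, zero_dotProduct]
      simp only [dotProduct, mul_sub, Finset.sum_sub_distrib] at h1
      exact sub_eq_zero.1 h1
    ext j
    by_contra hj
    refine hTconst j 0 1 (T j 0) zero_lt_one fun t _ => ?_
    have h1 := (hconst (Function.update 0 j t)).trans (hconst 0).symm
    rw [← Finset.add_sum_erase _ _ (Finset.mem_univ j),
      ← Finset.add_sum_erase _ _ (Finset.mem_univ j), Function.update_self] at h1
    have h2 : ∑ l ∈ Finset.univ.erase j, θ l * T l ((Function.update 0 j t : Fin d → ℝ) l) =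
        ∑ l ∈ Finset.univ.erase j, θ l * T l ((0 : Fin d → ℝ) l) :=
      Finset.sum_congr rfl fun l hl => by
        rw [Function.update_of_ne (Finset.ne_of_mem_erase hl)]
    rw [h2] at h1
    exact mul_left_cancel₀ hj (add_right_cancel h1)
  have hdet := (Matrix.isUnit_iff_isUnit_det _).1 hU
  -- If `H s` were constant on an interval, row `s` of `A⁻¹` would give a combination of the `T j (z
  -- j)` constant on an open set of `z`; moving one `z j` with nonzero coefficient is contradictory.
  have hHconst : ∀ s a b C, a < b → ¬ ∀ t ∈ Set.Icc a b, H s t = C := by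
    intro s a b C hab hC
    have hB : ∀ z, H s (v z s) = ∑ j, A⁻¹ s j * (T j (z j) - c j) := fun z => by
      have h1 := congrArg (fun w => A⁻¹ *ᵥ w) (hA' z)
      simp only [Matrix.mulVec_mulVec, Matrix.nonsing_inv_mul _ hdet, Matrix.one_mulVec] at h1
      exact (congrFun h1 s).symm
    obtain ⟨j, hj⟩ : ∃ j, A⁻¹ s j ≠ 0 := by
      by_contra! hzero
      have h1 := congrFun (congrFun (Matrix.nonsing_inv_mul A hdet) s) s
      simp [Matrix.mul_apply, hzero] at h1
    obtain ⟨t₀, ht₀⟩ := exists_between hab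
    set z₀ := u fun _ => t₀
    have hcont : Continuous fun t => v (Function.update z₀ j t) s :=
      (continuous_apply s).comp (hv.continuous.comp (continuous_const.update j continuous_id))
    have hev : ∀ᶠ t in nhds (z₀ j), v (Function.update z₀ j t) s ∈ Set.Icc a b := by
      refine hcont.continuousAt.eventually_mem (Icc_mem_nhds ?_ ?_) <;>
        simp [z₀, hvu, ht₀.1, ht₀.2]
    obtain ⟨ε, hε, hball⟩ := Metric.eventually_nhds_iff_ball.1 hev
    have hHz : ∀ t ∈ Set.Icc (z₀ j) (z₀ j + ε / 2), A⁻¹ s j * (T j t - c j) +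
        ∑ l ∈ Finset.univ.erase j, A⁻¹ s l * (T l (z₀ l) - c l) = C := fun t ht => by
      rw [← hC _ (hball t (by
        rw [Metric.mem_ball, Real.dist_eq, abs_lt]
        constructor <;> linarith [ht.1, ht.2])), hB, ← Finset.add_sum_erase _ _ (Finset.mem_univ j),
        Function.update_self]
      congr 1
      exact Finset.sum_congr rfl fun l hl => by
        rw [Function.update_of_ne (Finset.ne_of_mem_erase hl)]
    refine hTconst j (z₀ j) (z₀ j + ε / 2) (T j (z₀ j)) (by linarith) fun t ht => ?_
    have h1 := (hHz t ht).trans (hHz (z₀ j) ⟨le_rfl, by linarith⟩).symm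
    exact sub_left_injective (mul_left_cancel₀ hj (add_right_cancel h1))
  have hfirst : ∀ j s w, deriv (T j) (u w j) * fderiv ℝ u w (Pi.single s 1) j =
      A j s * deriv (H s) (w s) := by
    intro j s w
    have h1 : HasDerivAt (fun r : ℝ => T j (u (w + r • Pi.single s 1) j))
        (deriv (T j) (u w j) * fderiv ℝ u w (Pi.single s 1) j) 0 := by
      have h2 := HasDerivAt.comp (0 : ℝ) ((hT j _).hasDerivAt)
        (hasDerivAt_apply_line hu w (Pi.single s 1) j 0)
      simp only [zero_smul, add_zero] at h2
      exact h2
    have h2 : HasDerivAt (fun r : ℝ => T j (u (w + r • Pi.single s 1) j))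
        (A j s * deriv (H s) (w s)) 0 := by
      have heq : (fun r : ℝ => T j (u (w + r • Pi.single s 1) j)) = fun r : ℝ =>
          A j s * H s (w s + r) + (∑ i ∈ Finset.univ.erase s, A j i * H i (w i) + c j) := by
        ext1 r
        rw [hA, hvu, ← Finset.add_sum_erase _ _ (Finset.mem_univ s), add_assoc]
        congr 2
        · simp
        · refine Finset.sum_congr rfl fun i hi => ?_
          simp [Finset.ne_of_mem_erase hi]
      rw [heq]
      refine HasDerivAt.add_const _ (HasDerivAt.const_mul _ ?_)
      exact HasDerivAt.comp_const_add (w s) 0 (by rw [add_zero]; exact (hH s _).hasDerivAt)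
    exact h1.unique h2
  choose t ht using fun j =>
    exists_deriv_eq_zero_of_not_monotone_of_not_antitone (hT j) (hmono j).1 (hmono j).2
  -- on the level set of a critical value, the coordinates entering `T j` are constant
  have hlevel : ∀ j s, A j s ≠ 0 → ∀ z z', z j = t j → z' j = t j → v z s = v z' s := by
    intro j s hjs
    have hcrit : ∀ z, z j = t j → deriv (H s) (v z s) = 0 := fun z hz => by
      have h1 := hfirst j s (v z)
      rw [huv, hz, ht, zero_mul] at h1
      exact (mul_eq_zero.1 h1.symm).resolve_left hjs
    -- The segment from `z` to `z'` stays in the hyperplane and `v · s` takes all intermediate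
    -- values on it, so `H s` would be constant between them.
    have hle : ∀ z z', z j = t j → z' j = t j → ¬ v z s < v z' s := by
      intro z z' hz hz' hlt
      refine hHconst s _ _ _ hlt (const_on_Icc_of_hasDerivAt_zero fun τ hτ => ?_)
      have hcont : Continuous fun r : ℝ => v (z + r • (z' - z)) s :=
        (continuous_apply s).comp (hv.continuous.comp (by fun_prop))
      obtain ⟨r, hr⟩ : ∃ r : ℝ, v (z + r • (z' - z)) s = τ :=
        mem_range_of_exists_le_of_exists_ge hcont ⟨0, by simpa using hτ.1⟩ ⟨1, by simpa using hτ.2⟩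
      have h1 := hcrit (z + r • (z' - z)) (by simp [hz, hz'])
      rw [hr] at h1
      rw [← h1]
      exact (hH s τ).hasDerivAt
    exact fun z z' hz hz' =>
      le_antisymm (not_lt.1 (hle z' z hz' hz)) (not_lt.1 (hle z z' hz hz'))
  -- The constant vector `t j` is just a convenient point of the hyperplane `z j = t j`; there row
  -- `s` of the Jacobian of `v` is supported on column `j`.
  have hpartial : ∀ j s, A j s ≠ 0 → ∀ l, l ≠ j →
      fderiv ℝ v (fun _ => t j) (Pi.single l 1) s = 0 := by
    intro j s hjs l hl
    have h1 := hasDerivAt_apply_line hv (fun _ => t j) (Pi.single l 1) s 0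
    simp only [zero_smul, add_zero] at h1
    refine h1.unique ?_
    have h2 : (fun r : ℝ => v ((fun _ => t j) + r • Pi.single l 1) s) =
        fun _ => v (fun _ => t j) s := by
      ext r
      exact hlevel j s hjs _ _ (by simp [hl.symm]) rfl
    rw [h2]
    exact hasDerivAt_const _ _
  have hunique : ∀ j s s', A j s ≠ 0 → A j s' ≠ 0 → s = s' := fun j s s' hs hs' =>
    LinearMap.eq_of_surjective_of_apply_single_eq_zero
      (L := (fderiv ℝ v fun _ => t j).toLinearMap)
      (surjective_fderiv_of_inverse hv hu hvu huv _) (hpartial j s hs) (hpartial j s' hs')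
  have hsurj : Function.Surjective A.mulVecLin := fun x => ⟨A⁻¹ *ᵥ x, by
    rw [Matrix.mulVecLin_apply, Matrix.mulVec_mulVec, Matrix.mul_nonsing_inv _ hdet,
      Matrix.one_mulVec]⟩
  have hex : ∀ j, ∃ s, A j s ≠ 0 := by
    intro j
    by_contra! hzero
    have h1 := congrFun (congrFun (Matrix.mul_nonsing_inv A hdet) j) j
    simp [Matrix.mul_apply, hzero] at h1
  choose s hs using hex
  have hzero : ∀ j l, l ≠ s j → A j l = 0 := fun j l hl => by
    by_contra h
    exact hl (hunique j l (s j) h (hs j))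
  have hinj : Function.Injective s := fun i j hij =>
    LinearMap.eq_of_surjective_of_apply_single_eq_zero hsurj (s := s i)
      (fun l hl => by simpa using hzero i l hl) (fun l hl => by simpa using hzero j l (hij ▸ hl))
  set σ := Equiv.ofBijective s (Finite.injective_iff_bijective.1 hinj)
  refine ⟨σ.symm, fun i w w' hww' => ?_⟩
  have hsi : s (σ.symm i) = i := Equiv.ofBijective_apply_symm_apply s _ i
  rw [hA, hA, hvu, hvu]
  congr 1
  refine Finset.sum_congr rfl fun l _ => ?_
  by_cases hl : l = i
  · rw [hl, hww']
  · rw [hzero _ l (by rwa [hsi]), zero_mul, zero_mul]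

/-! ### The identifiability theorem -/

theorem theorem4 {d : ℕ} {k m : Fin d → ℕ} {Y : Type*}
    -- the generative model
    (h : (Fin d → ℝ) → (Fin d → ℝ))
    (T : ∀ i, ℝ → Fin (k i) → ℝ) (lam : ∀ i, Y → Fin (k i) → ℝ)
    (μ : (Fin d → ℝ) → ℝ) (Γ : Y → ℝ) (P : Y → Measure (Fin d → ℝ))
    -- the fitted energy model
    (H : ∀ i, ℝ → Fin (m i) → ℝ) (f : (Fin d → ℝ) → (Fin d → ℝ))
    (g : ∀ i, Y → Fin (m i) → ℝ)
    (hdata : FollowsIMCA h T lam μ Γ P)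
    (hTdiff : ∀ i, Differentiable ℝ (T i))
    (hTexp : ∀ i, StronglyExponential (T i))
    (hL : ∃ (y₀ : Y) (y : (Σ i, Fin (k i)) → Y), IsUnit (lambdaDiffMatrix lam y₀ y))
    (hHdiff : ∀ i, Differentiable ℝ (H i))
    (hdim : ∃ σ : Equiv.Perm (Fin d), ∀ i, m i = k (σ i))
    (hcase :
      ((∀ i, 2 ≤ k i) ∧ (∀ i, TwiceDifferentiable (T i)) ∧ IsD2Diffeo h ∧ IsD2Diffeo f) ∨
      ((∀ i, k i = 1) ∧
        (∀ i j, ¬ Monotone (fun t => T i t j) ∧ ¬ Antitone (fun t => T i t j)) ∧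
        IsC1Diffeo h ∧ IsC1Diffeo f))
    (hfit : FitsExactly H f g P) :
    ∃ (γ : Equiv.Perm (Fin d)) (A : ∀ i, Matrix (Fin (m i)) (Fin (k (γ i))) ℝ)
      (b : ∀ i, Fin (m i) → ℝ),
      ∀ i, m i = k (γ i) ∧
        (∃ B : Matrix (Fin (k (γ i))) (Fin (m i)) ℝ, A i * B = 1 ∧ B * A i = 1) ∧
        ∀ x z : Fin d → ℝ, x = h z → H i (f x i) = A i *ᵥ T (γ i) (z (γ i)) + b i := by
  have hTc := fun i => (hTdiff i).continuous
  have hHc := fun i => (hHdiff i).continuous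
  rcases hcase with ⟨hk, hT2, ⟨ψ, hψh, hhψ, hh, hψ⟩, ⟨φ, hφf, hfφ, hf, hφ⟩⟩ |
    ⟨hk, hmono, ⟨ψ, hψh, hhψ, hh, hψ⟩, ⟨φ, hφf, hfφ, hf, hφ⟩⟩
  · obtain ⟨A, c, hA⟩ := exists_affine_of_isUnit_lambdaDiffMatrix hdata hfit hL hTc hHc
      hh.1.continuous hψ.1.continuous hf.1.continuous hψh
    have huv : ∀ z, ψ (φ (f (h z))) = z := fun z => by rw [hφf, hψh]
    have hvu : ∀ w, f (h (ψ (φ w))) = w := fun w => by rw [hhψ, hfφ]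
    obtain ⟨γ, hγ⟩ := exists_perm_of_twiceDifferentiable (u := fun w => ψ (φ w))
      (v := fun z => f (h z)) (hψ.comp hφ) (hf.1.comp hh.1) huv hvu hk hT2 hTexp hHdiff hA
    obtain ⟨A', b, hAb⟩ := exists_block_affine (u := fun w => ψ (φ w))
      (v := fun z => f (h z)) huv hvu hTexp hdim hA γ
      fun i w w' hw => congrArg _ (hγ i w w' hw)
    exact ⟨γ, A', b, fun i => ⟨(hAb i).1, (hAb i).2.1, fun x z hx => hx ▸ (hAb i).2.2 z⟩⟩
  · obtain ⟨A, c, hA⟩ := exists_affine_of_isUnit_lambdaDiffMatrix hdata hfit hL hTc hHc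
      hh.continuous hψ.continuous hf.continuous hψh
    have huv : ∀ z, ψ (φ (f (h z))) = z := fun z => by rw [hφf, hψh]
    have hvu : ∀ w, f (h (ψ (φ w))) = w := fun w => by rw [hhψ, hfφ]
    have hm : ∀ i, m i = 1 := fun i => by
      obtain ⟨σ, hσ⟩ := hdim
      rw [hσ, hk]
    -- Substitution turns every index type into `Fin 1`, so that the index `0` is available.
    obtain rfl : k = fun _ => 1 := funext hk
    obtain rfl : m = fun _ => 1 := funext hm
    have hsingle : ∀ {a b : Fin 1 → ℝ}, a 0 = b 0 → a = b := fun hab => by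
      ext l
      rwa [Subsingleton.elim l 0]
    obtain ⟨γ, hγ⟩ := exists_perm_of_not_monotone (T := fun i t => T i t 0)
      (H := fun i t => H i t 0) (A := Matrix.of fun j i => A j i 0 0) (c := fun j => c j 0)
      (u := fun w => ψ (φ w)) (v := fun z => f (h z))
      ((hψ.differentiable one_ne_zero).comp (hφ.differentiable one_ne_zero))
      ((hf.differentiable one_ne_zero).comp (hh.differentiable one_ne_zero)) huv hvu
      (fun i => differentiable_pi.1 (hTdiff i) 0) (fun i => differentiable_pi.1 (hHdiff i) 0)
      (fun i a b e hab he => by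
        have h1 : (fun _ => 1 : Fin 1 → ℝ) = 0 :=
          eq_zero_of_dotProduct_eq_const (hTexp i) hab (c := e) fun t ht => by
            simpa [dotProduct] using he t ht
        exact one_ne_zero (congrFun h1 0))
      (fun i => hmono i 0)
      (fun z j => by
        rw [hA z j]
        simp [Matrix.mulVec, dotProduct])
    obtain ⟨A', b, hAb⟩ := exists_block_affine (u := fun w => ψ (φ w))
      (v := fun z => f (h z)) huv hvu hTexp hdim hA γ
      fun i w w' hw => hsingle (hγ i w w' hw)
    exact ⟨γ, A', b, fun i => ⟨(hAb i).1, (hAb i).2.1, fun x z hx => hx ▸ (hAb i).2.2 z⟩⟩
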